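/- Let $\mathbb K$ be $\mathbb R$ or $\mathbb C$, let $G$ be a finite-dimensional Lie group over $\mathbb K$ with identity $e$, Lie algebra $\mathfrak g$ and adjoint representation $\mathrm{Ad}$. Let $X$ be a finite set, $F=\langle X\rangle$ the free group on $X$, $(r_j)_{j\in R}$ a finite family of elements of $F$ (the relators), $N$ the normal closure of $\{r_j : j\in R\}$ in $F$, and $\Pi=F/N$. Each word $w\in F$ defines a map $\tilde w\colon G^X\to G$ by substituting elements of $G$ for the generators. Let $\mathbf r=(\tilde r_j)_{j\in R}\colon G^X\to G^R$; the set $\mathrm{Hom}(\Pi,G)$ is identified with $\mathbf r^{-1}(e,\dots,e)\subset G^X$ by $\phi\mapsto(\phi(x))_{x\in X}$. Fix $\phi\in\mathrm{Hom}(\Pi,G)$ and let $\mathfrak g_{\mathrm{Ad}\,\phi}$ be $\mathfrak g$ with the action of $\Pi$ through $\mathrm{Ad}\circ\phi$. Identify $T_\phi G^X$ with $\mathfrak g^X$ through the infinitesimal action of $G$ on itself by left multiplication, $\xi\mapsto\frac{d}{dt}\big|_{t=0}\exp(t\xi)g\in T_gG$, in each factor, and $T_{(e,\dots,e)}G^R$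 with $\mathfrak g^R$. Let $Z^1(\Pi,\mathfrak g_{\mathrm{Ad}\,\phi})$ be the space of maps $c\colon\Pi\to\mathfrak g$ with $c(ab)=c(a)+\mathrm{Ad}_{\phi(a)}c(b)$. Let $\mathrm{Hom}(N,\mathfrak g_{\mathrm{Ad}\,\phi})^\Pi$ be the space of group homomorphisms $\beta\colon N\to\mathfrak g$ that are invariant under the action of $\Pi$ induced by $(s\cdot\beta)(n)=\mathrm{Ad}_{\phi(s)}\beta(s^{-1}ns)$, $s\in F$, and let $\mathrm{ev}_R\colon\mathrm{Hom}(N,\mathfrak g_{\mathrm{Ad}\,\phi})^\Pi\to\mathfrak g^R$, $\beta\mapsto(\beta(r_j))_{j\in R}$. Then $\mathbf r$ is differentiable at $\phi$, and its differential $(d\mathbf r)_\phi\colon\mathfrak g^X\to\mathfrak g^R$ has the following properties. 1. The restriction to the generators, $c\mapsto(c(\bar x))_{x\in X}$, where $\bar x\in\Pi$ is the class of $x$, embeds $Z^1(\Pi,\mathfrak g_{\mathrm{Ad}\,\phi})$ in $\mathfrak g^X$, and its image is $\ker(d\mathbf r)_\phi$; that is, $\ker(d\mathbf r)_\phi=Z^1(\Pi,\mathfrak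 g_{\mathrm{Ad}\,\phi})$. 2. The map $\mathrm{ev}_R$ is injective, and $\mathrm{im}(d\mathbf r)_\phi$ is contained in $\mathrm{im}(\mathrm{ev}_R)\cong\mathrm{Hom}(N,\mathfrak g_{\mathrm{Ad}\,\phi})^\Pi$. 3. The spaces $\mathrm{Hom}(N,\mathfrak g_{\mathrm{Ad}\,\phi})^\Pi$ and $H^2(\Pi,\mathfrak g_{\mathrm{Ad}\,\phi})$ (group cohomology) are finite-dimensional over $\mathbb K$, and $$\mathrm{rank}(d\mathbf r)_\phi=\dim\mathrm{Hom}(N,\mathfrak g_{\mathrm{Ad}\,\phi})^\Pi-\dim H^2(\Pi,\mathfrak g_{\mathrm{Ad}\,\phi}).$$ 4. If $\mathrm{Hom}(N,\mathfrak g_{\mathrm{Ad}\,\phi})^\Pi\cong\mathfrak g^R$ as vector spaces, then $\mathrm{coker}(d\mathbf r)_\phi\cong H^2(\Pi,\mathfrak g_{\mathrm{Ad}\,\phi})$ as vector spaces. -/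

import Mathlib

open scoped Manifold ContDiff

universe u

noncomputable section

/-! ### The adjoint representation of a Lie group -/

section Adjoint

variable {𝕜 : Type*} [NontriviallyNormedField 𝕜]
  {E : Type*} [NormedAddCommGroup E] [NormedSpace 𝕜 E]
  {H : Type*} [TopologicalSpace H] (I : ModelWithCorners 𝕜 E H)
  {G : Type*} [TopologicalSpace G] [ChartedSpace H G] [Group G]

/-- The derivative at the identity of the conjugation `h ↦ g * h * g⁻¹`, as an endomorphism of
the Lie algebra (recall that `g * 1 * g⁻¹ = 1`). -/
def lieAd (g : G) : GroupLieAlgebra I G →L[𝕜] GroupLieAlgebra I G :=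
  mfderiv I I (fun h : G => g * h * g⁻¹) 1

theorem lieAd_one : lieAd I (1 : G) = ContinuousLinearMap.id 𝕜 (GroupLieAlgebra I G) := by
  have h1 : (fun h : G => (1 : G) * h * (1 : G)⁻¹) = id := by
    funext h; simp
  unfold lieAd
  rw [h1]
  exact mfderiv_id

variable [LieGroup I ∞ G]

theorem mdifferentiableAt_conj (g h : G) :
    MDifferentiableAt I I (fun h : G => g * h * g⁻¹) h := by
  have h1 : ContMDiff I I ∞ (fun h : G => g * h * g⁻¹) :=
    (contMDiff_mul_right (a := g⁻¹)).comp (contMDiff_mul_left (a := g))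
  exact h1.mdifferentiableAt (by simp)

theorem lieAd_mul (a b : G) : lieAd I (a * b) = (lieAd I a).comp (lieAd I b) := by
  have h1 : (fun h : G => (a * b) * h * (a * b)⁻¹)
      = (fun h : G => a * h * a⁻¹) ∘ (fun h : G => b * h * b⁻¹) := by
    funext h; simp [mul_assoc]
  have h2 : b * 1 * b⁻¹ = (1 : G) := by simp
  have h3 : ∀ x : G, x = 1 →
      ((mfderiv I I (fun h : G => a * h * a⁻¹) x : E →L[𝕜] E)
        = (mfderiv I I (fun h : G => a * h * a⁻¹) (1 : G) : E →L[𝕜] E)) := by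
    rintro _ rfl; rfl
  have h4 := mfderiv_comp_of_eq (y := b * 1 * b⁻¹) (mdifferentiableAt_conj I a (b * 1 * b⁻¹))
    (mdifferentiableAt_conj I b 1) rfl
  rw [← h1] at h4
  refine Eq.trans h4 ?_
  exact congrArg (fun L : E →L[𝕜] E => L.comp (lieAd I b : E →L[𝕜] E)) (h3 _ h2)

variable (G) in
/-- The adjoint representation `Ad` of the Lie group `G` on its Lie algebra `𝔤`. -/
def adjointRep : Representation 𝕜 G (GroupLieAlgebra I G) where
  toFun g := (lieAd I g : GroupLieAlgebra I G →ₗ[𝕜] GroupLieAlgebra I G)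
  map_one' := by rw [lieAd_one]; rfl
  map_mul' a b := by rw [lieAd_mul]; rfl

end Adjoint

/-! ### The `F ⧸ N`-module `Hom(N, V)` -/

section HomModule

variable {𝕜 : Type*} [CommRing 𝕜] {F : Type*} [Group F] (N : Subgroup F) [N.Normal]
  {V : Type*} [AddCommGroup V] [Module 𝕜 V]

/-- For a representation `ρ` of `F ⧸ N` on `V`, the group `F` acts on `Hom(N, V)`
(group homomorphisms from `N` to the additive group `V`) through conjugation on `N` and `ρ` on `V`:
`(s • β)(n) = ρ(s)(β(s⁻¹ * n * s))`. -/
def conjHomRep (ρ : Representation 𝕜 (F ⧸ N) V) : Representation 𝕜 F (Additive N →+ V) where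
  toFun s :=
    { toFun := fun β =>
        ((ρ (s : F ⧸ N)).toAddMonoidHom.comp β).comp
          (MonoidHom.toAdditive (MulAut.conjNormal s⁻¹ : N ≃* N).toMonoidHom)
      map_add' := fun β γ => by ext n; simp
      map_smul' := fun c β => by ext n; simp }
  map_one' := by ext β n; simp
  map_mul' s t := by ext β n; simp

theorem conjHomRep_apply (ρ : Representation 𝕜 (F ⧸ N) V) (s : F) (β : Additive N →+ V)
    (n : N) :
    conjHomRep N ρ s β (Additive.ofMul n)
      = ρ (s : F ⧸ N) (β (Additive.ofMul (MulAut.conjNormal s⁻¹ n))) := rfl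

/-- `N` acts trivially on `Hom(N, V)`. -/
instance conjHomRep_isTrivial (ρ : Representation 𝕜 (F ⧸ N) V) :
    Representation.IsTrivial ((conjHomRep N ρ).comp N.subtype) where
  out s := by
    ext β n
    obtain ⟨n, rfl⟩ := Additive.ofMul.surjective n
    have h1 : ((s : F) : F ⧸ N) = 1 := (QuotientGroup.eq_one_iff (s : F)).2 s.2
    have h2 : (MulAut.conjNormal (s : F)⁻¹ n : N) = s⁻¹ * n * s := by
      ext; simp
    change conjHomRep N ρ (s : F) β (Additive.ofMul n) = β (Additive.ofMul n)
    rw [conjHomRep_apply, h1, h2]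
    simp [ofMul_mul, ofMul_inv]

/-- The induced action of `F ⧸ N` on `Hom(N, V)`. -/
def quotientHomRep (ρ : Representation 𝕜 (F ⧸ N) V) :
    Representation 𝕜 (F ⧸ N) (Additive N →+ V) :=
  Representation.ofQuotient (conjHomRep N ρ) N

/-- The space `Hom(N, V)^(F ⧸ N)` of invariant homomorphisms. -/
abbrev InvariantHom (ρ : Representation 𝕜 (F ⧸ N) V) : Submodule 𝕜 (Additive N →+ V) :=
  (quotientHomRep N ρ).invariants

/-- Evaluation of invariant homomorphisms at a family of elements of `N`. -/
def evalInvariantHom (ρ : Representation 𝕜 (F ⧸ N) V) {R : Type*} (r : R → N) :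
    InvariantHom N ρ →ₗ[𝕜] (R → V) where
  toFun β := fun j => (β : Additive N →+ V) (Additive.ofMul (r j))
  map_add' _ _ := rfl
  map_smul' _ _ := rfl

end HomModule

/-! ### Finite presentations and the relator map -/

section Presentation

variable {X R : Type*} (r : R → FreeGroup X)

/-- The normal closure `N` of the relators in the free group `F = ⟨X⟩`. -/
abbrev relatorSubgroup : Subgroup (FreeGroup X) := Subgroup.normalClosure (Set.range r)

/-- The group `Π = F ⧸ N` with generators `X` and relators `r`. -/
abbrev PresGroup : Type _ := FreeGroup X ⧸ relatorSubgroup r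

/-- The image in `Π` of a generator. -/
def presGen (x : X) : PresGroup r := QuotientGroup.mk (FreeGroup.of x)

/-- The relators, as elements of `N`. -/
def relator (j : R) : relatorSubgroup r :=
  ⟨r j, Subgroup.subset_normalClosure (Set.mem_range_self j)⟩

variable {G : Type*} [Group G]

/-- The map `w̃ : G^X → G` that substitutes elements of `G` for the generators in a word `w`. -/
def wordMap (w : FreeGroup X) (g : X → G) : G := FreeGroup.lift g w

/-- The relator map `G^X → G^R`. -/
def relatorMap (g : X → G) : R → G := fun j => wordMap (r j) g

/-- The point of `G^X = Hom(F, G)` that corresponds to `φ ∈ Hom(Π, G)`. -/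
def homPoint (φ : PresGroup r →* G) : X → G := fun x => φ (presGen r x)

/-- At the points of `Hom(Π, G)` the relator map takes the value `(e, …, e)`. -/
theorem relatorMap_homPoint (φ : PresGroup r →* G) : relatorMap r (homPoint r φ) = 1 := by
  have h1 : FreeGroup.lift (homPoint r φ) = φ.comp (QuotientGroup.mk' (relatorSubgroup r)) := by
    ext x; simp [homPoint, presGen]
  funext j
  have h2 : ((r j : FreeGroup X) : PresGroup r) = 1 :=
    (QuotientGroup.eq_one_iff (r j)).2 (relator r j).2
  simp [relatorMap, wordMap, h1, h2]

end Presentation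

section Differential

variable {𝕜 : Type*} [NontriviallyNormedField 𝕜]
  {E : Type*} [NormedAddCommGroup E] [NormedSpace 𝕜 E]
  {H : Type*} [TopologicalSpace H] (I : ModelWithCorners 𝕜 E H)
  {G : Type*} [TopologicalSpace G] [ChartedSpace H G] [Group G]

/-- The identification `𝔤 → T_g G` given by the infinitesimal action of `G` on itself by left
multiplication, `ξ ↦ d/dt exp(t ξ) g`; it is the derivative at the identity of `h ↦ h * g`. -/
def lieTransport (g : G) : GroupLieAlgebra I G →L[𝕜] TangentSpace I g :=
  mfderiv I I (fun h : G => h * g) 1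

/-- The induced identification `𝔤^X → T_g (G^X)` at a point `g` of the product manifold `G^X`
(whose tangent space is by construction the product of the tangent spaces of the factors). -/
def lieTransportPi {X : Type*} [Fintype X] (g : X → G) :
    (X → GroupLieAlgebra I G) →ₗ[𝕜] TangentSpace (ModelWithCorners.pi fun _ : X => I) g :=
  (LinearMap.pi fun x =>
    ((lieTransport I (g x)).toLinearMap.comp (LinearMap.proj x) :
      (X → GroupLieAlgebra I G) →ₗ[𝕜] E) : (X → GroupLieAlgebra I G) →ₗ[𝕜] (X → E))

/-- The differential at `φ ∈ Hom(Π, G)` of the relator map `G^X → G^R`, as a linear map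
`𝔤^X → 𝔤^R`. The source is the tangent space of `G^X` at `φ`, identified with `𝔤^X` by
`lieTransportPi`; the target is the tangent space of `G^R` at `(e, …, e)`, which is `𝔤^R`. -/
def relatorDifferential {X R : Type*} [Fintype X] [Fintype R] (r : R → FreeGroup X)
    (φ : PresGroup r →* G) :
    (X → GroupLieAlgebra I G) →ₗ[𝕜] (R → GroupLieAlgebra I G) :=
  (mfderiv (ModelWithCorners.pi fun _ : X => I) (ModelWithCorners.pi fun _ : R => I)
    (relatorMap r : (X → G) → (R → G)) (homPoint r φ)).toLinearMap.comp
      (lieTransportPi I (homPoint r φ))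

variable [LieGroup I ∞ G]

/-- The representation `Ad ∘ φ` of `Π` on `𝔤`. -/
def adRep {Q : Type*} [Group Q] (φ : Q →* G) : Representation 𝕜 Q (GroupLieAlgebra I G) :=
  (adjointRep I G).comp φ

end Differential

end

/-! Write `V` for `𝔤` with the action `Ad ∘ φ`. The differential at `φ` of the word map of `w`,
translated on the right to the identity, is a 1-cocycle in `w` on the free group `F`
(`wordDifferential_mul`). A cocycle on `F` is freely determined by its values at the generators, so
`𝔤^X ≅ Z¹(F, V)`, and `(d𝐫)_φ` is this isomorphism followed by restriction to `N` and by `ev_R`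
(`eq_evalInvariantHom_comp`).

Since `N` is generated by conjugates of relators, `ev_R` is injective. A cocycle that vanishes at
the relators thus vanishes on `N` and descends to `Π`; this gives the kernel.

The rank comes from the exact sequence `Z¹(F, V) → Hom(N, V)^Π → H²(Π, V) → 0`, proved with explicit
cocycles (`ker_transgression`, `transgression_surjective`); surjectivity holds because extensions
split over a free group (`freeGroup_cocycle₂_splits`). Statements 3 and 4 are then dimension counts.
-/

noncomputable section

/-! ### Transgression and its exact sequence. -/

section Transgression

open groupCohomology

variable {k : Type u} [CommRing k] {F : Type u} [Group F] (N : Subgroup F) [N.Normal]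
  {V : Type u} [AddCommGroup V] [Module k V] (ρ : Representation k (F ⧸ N) V)

/-- The representation of `F` obtained from a representation of `F ⧸ N`. -/
abbrev inflation : Representation k F V := ρ.comp (QuotientGroup.mk' N)

variable {N} in
theorem quotient_coe_eq_one (n : N) : ((n : F) : F ⧸ N) = 1 :=
  (QuotientGroup.eq_one_iff (n : F)).2 n.2

variable {ρ} in
theorem cocycle_map_mul {D : F → V} (hD : D ∈ cocycles₁ (Rep.of (inflation N ρ))) (s t : F) :
    D (s * t) = D s + ρ (s : F ⧸ N) (D t) := by
  have h := (mem_cocycles₁_iff (A := Rep.of (inflation N ρ)) D).1 hD s t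
  rw [h, add_comm]; rfl

variable {ρ} in
theorem mem_cocycles_inflation {D : F → V}
    (hD : ∀ s t, D (s * t) = D s + ρ (s : F ⧸ N) (D t)) :
    D ∈ cocycles₁ (Rep.of (inflation N ρ)) :=
  (mem_cocycles₁_iff (A := Rep.of (inflation N ρ)) D).2 fun s t => by
    rw [hD, add_comm]; rfl

variable {ρ} in
theorem cocycle_map_one {D : F → V} (hD : D ∈ cocycles₁ (Rep.of (inflation N ρ))) : D 1 = 0 := by
  simpa using cocycle_map_mul N hD 1 1

variable {N ρ} in
theorem mem_invariantHom_iff {β : Additive N →+ V} :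
    β ∈ InvariantHom N ρ ↔ ∀ (s : F) (n : N),
      β (Additive.ofMul (MulAut.conjNormal s n)) = ρ (s : F ⧸ N) (β (Additive.ofMul n)) := by
  have key : β ∈ InvariantHom N ρ ↔ ∀ s : F, conjHomRep N ρ s β = β :=
    ⟨fun h s => h (s : F ⧸ N), fun h s => QuotientGroup.induction_on s h⟩
  rw [key]
  refine forall_congr' fun s => ⟨fun h n => ?_, fun h => ?_⟩
  · conv_lhs => rw [← h]
    rw [conjHomRep_apply, ← MulAut.mul_apply, ← map_mul]
    simp
  · ext n
    obtain ⟨n, rfl⟩ := Additive.ofMul.surjective n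
    change conjHomRep N ρ s β (Additive.ofMul n) = β (Additive.ofMul n)
    rw [conjHomRep_apply, ← h, ← MulAut.mul_apply, ← map_mul]
    simp

/-- The restriction to `N` of a 1-cocycle on `F` is an invariant homomorphism. -/
def cocycleRestriction : cocycles₁ (Rep.of (inflation N ρ)) →ₗ[k] InvariantHom N ρ where
  toFun D :=
    ⟨AddMonoidHom.mk' (fun n => D.1 (n.toMul : F)) fun m n => by
        have := cocycle_map_mul N D.2 (m.toMul : F) (n.toMul : F)
        rw [quotient_coe_eq_one, map_one] at this
        exact this,
      mem_invariantHom_iff.2 fun s n => by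
        change D.1 (MulAut.conjNormal s n : N) = ρ (s : F ⧸ N) (D.1 n)
        have h1 := cocycle_map_mul N D.2 (s * n * s⁻¹) s
        have h2 := cocycle_map_mul N D.2 s n
        have h3 : ((s * n * s⁻¹ : F) : F ⧸ N) = 1 := by
          rw [QuotientGroup.mk_mul, QuotientGroup.mk_mul, quotient_coe_eq_one]; simp
        rw [h3, map_one, inv_mul_cancel_right, h2, add_comm] at h1
        rw [MulAut.conjNormal_apply]
        exact (add_right_cancel h1).symm⟩
  map_add' _ _ := rfl
  map_smul' _ _ := rfl

@[simp]
theorem cocycleRestriction_apply (D : cocycles₁ (Rep.of (inflation N ρ))) (n : N) :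
    (cocycleRestriction N ρ D : Additive N →+ V) (Additive.ofMul n) = D.1 n := rfl

variable {N} in
/-- The element of `N` by which `s` differs from the chosen representative of its class. -/
def sectionDefect (s : F) : N :=
  ⟨s * ((s : F ⧸ N).out)⁻¹, by
    rw [← QuotientGroup.eq_one_iff, QuotientGroup.mk_mul, QuotientGroup.mk_inv,
      QuotientGroup.out_eq', mul_inv_cancel]⟩

theorem sectionDefect_mul (n : N) (s : F) :
    sectionDefect ((n : F) * s) = n * (sectionDefect s : N) := by
  ext
  have : (((n : F) * s : F) : F ⧸ N) = s := by
    rw [QuotientGroup.mk_mul, quotient_coe_eq_one, one_mul]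
  simp [sectionDefect, this, mul_assoc]

variable {N} in
/-- The extension of a homomorphism on `N` to `F` that vanishes on a set of representatives. -/
def extendBySection (β : Additive N →+ V) (s : F) : V := β (Additive.ofMul (sectionDefect s))

variable {N} in
theorem extendBySection_mul (β : Additive N →+ V) (n : N) (s : F) :
    extendBySection β (n * s) = β (Additive.ofMul n) + extendBySection β s := by
  simp [extendBySection, sectionDefect_mul]

variable {N ρ} in
-- Write `s * n * t` as `(s * n * s⁻¹) * (s * t)`; invariance of `β` evaluates the first factor.
theorem extendBySection_mul_mul {β : Additive N →+ V} (hβ : β ∈ InvariantHom N ρ)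
    (s : F) (n : N) (t : F) :
    extendBySection β (s * (n * t))
      = ρ (s : F ⧸ N) (β (Additive.ofMul n)) + extendBySection β (s * t) := by
  rw [← mem_invariantHom_iff.1 hβ, ← extendBySection_mul]
  congr 1
  simp [mul_assoc]

theorem exists_mul_out (s : F) : ∃ n : N, s = n * (s : F ⧸ N).out :=
  ⟨sectionDefect s, by simp [sectionDefect]⟩

variable {N} in
/-- A function on `F` that is constant on the classes modulo `N` is a function on `F ⧸ N`. -/
theorem exists_descent {W : Type*} {g : F → W} (hg : ∀ (n : N) (s : F), g (n * s) = g s) :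
    ∃ c : F ⧸ N → W, ∀ s : F, c s = g s :=
  ⟨fun a => g a.out, fun s => by
    obtain ⟨n, hn⟩ := exists_mul_out N s
    conv_rhs => rw [hn]
    exact (hg n _).symm⟩

/-- The 2-cocycle on `F ⧸ N` of an invariant homomorphism on `N`. -/
def transgressionCochain (β : Additive N →+ V) (p : (F ⧸ N) × (F ⧸ N)) : V :=
  ρ p.1 (extendBySection β p.2.out) - extendBySection β (p.1.out * p.2.out)
    + extendBySection β p.1.out

variable {N ρ} in
-- The coboundary on `F` of the extended `β` does not change when `s` and `t` are replaced by their
-- representatives. The cochain is therefore its descent to `F ⧸ N`, and later computations can be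
-- made in `F`.
theorem transgressionCochain_coe {β : Additive N →+ V} (hβ : β ∈ InvariantHom N ρ) (s t : F) :
    transgressionCochain N ρ β (s, t) = ρ (s : F ⧸ N) (extendBySection β t)
      - extendBySection β (s * t) + extendBySection β s := by
  obtain ⟨m, hm⟩ := exists_mul_out N s
  obtain ⟨n, hn⟩ := exists_mul_out N t
  have h1 : extendBySection β s = β (Additive.ofMul m) + extendBySection β (s : F ⧸ N).out := by
    conv_lhs => rw [hm]
    exact extendBySection_mul _ _ _
  have h2 : extendBySection β t = β (Additive.ofMul n) + extendBySection β (t : F ⧸ N).out := by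
    conv_lhs => rw [hn]
    exact extendBySection_mul _ _ _
  have h3 : extendBySection β (s * t) = β (Additive.ofMul m) + (ρ (s : F ⧸ N)
      (β (Additive.ofMul n)) + extendBySection β ((s : F ⧸ N).out * (t : F ⧸ N).out)) := by
    conv_lhs => rw [hm, hn]
    rw [mul_assoc, extendBySection_mul, extendBySection_mul_mul hβ, QuotientGroup.out_eq']
  rw [transgressionCochain, h1, h2, h3, map_add]
  abel

/-- The pullback of `f` to `F` is a coboundary, and the cocycle identity can be tested on lifts to
`F`. -/
theorem mem_cocycles_of_inflation_eq {f : (F ⧸ N) × (F ⧸ N) → V} {h : F → V}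
    (hf : ∀ s t : F, f (s, t) = ρ (s : F ⧸ N) (h t) - h (s * t) + h s) :
    f ∈ cocycles₂ (Rep.of ρ) := by
  refine (mem_cocycles₂_iff (A := Rep.of ρ) f).2 fun a b c => ?_
  induction a using QuotientGroup.induction_on with | _ a
  induction b using QuotientGroup.induction_on with | _ b
  induction c using QuotientGroup.induction_on with | _ c
  change f (((a * b : F) : F ⧸ N), c) + f (a, b)
    = ρ (a : F ⧸ N) (f (b, c)) + f (a, ((b * c : F) : F ⧸ N))
  rw [hf, hf, hf, hf, QuotientGroup.mk_mul, map_mul, map_add, map_sub, mul_assoc]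
  simp only [Module.End.mul_apply]
  abel

/-- The cocycle of an invariant homomorphism, as a linear map. -/
def transgressionCocycle : InvariantHom N ρ →ₗ[k] cocycles₂ (Rep.of ρ) where
  toFun β := ⟨transgressionCochain N ρ β.1,
    mem_cocycles_of_inflation_eq N ρ (transgressionCochain_coe β.2)⟩
  map_add' β γ := by
    refine Subtype.ext (funext fun p => ?_)
    change transgressionCochain N ρ (β.1 + γ.1) p
      = transgressionCochain N ρ β.1 p + transgressionCochain N ρ γ.1 p
    simp only [transgressionCochain, extendBySection, AddMonoidHom.add_apply, map_add]
    abel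
  map_smul' c β := by
    refine Subtype.ext (funext fun p => ?_)
    change transgressionCochain N ρ (c • β.1) p = c • transgressionCochain N ρ β.1 p
    simp only [transgressionCochain, extendBySection, AddMonoidHom.smul_apply, map_smul,
      smul_add, smul_sub]

/-- The transgression `Hom(N, V)^(F ⧸ N) → H²(F ⧸ N, V)`. -/
def transgression : InvariantHom N ρ →ₗ[k] H2 (Rep.of ρ) :=
  (H2π (Rep.of ρ)).hom.comp (transgressionCocycle N ρ)

theorem mem_coboundaries₂_iff_exists {f : (F ⧸ N) × (F ⧸ N) → V} :
    f ∈ coboundaries₂ (Rep.of ρ) ↔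
      ∃ c : F ⧸ N → V, ∀ s t : F, f (s, t) = ρ (s : F ⧸ N) (c t) - c (s * t : F) + c s := by
  constructor
  · rintro ⟨c, rfl⟩
    exact ⟨c, fun s t => rfl⟩
  · rintro ⟨c, hc⟩
    refine ⟨c, ?_⟩
    ext ⟨a, b⟩
    induction a using QuotientGroup.induction_on with | _ a
    induction b using QuotientGroup.induction_on with | _ b
    exact (hc a b).symm

/-- Exactness of `Z¹(F, V) → Hom(N, V)^(F ⧸ N) → H²(F ⧸ N, V)`. -/
theorem ker_transgression :
    LinearMap.ker (transgression N ρ) = LinearMap.range (cocycleRestriction N ρ) := by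
  ext β
  rw [LinearMap.mem_ker]
  have h0 : transgression N ρ β = 0 ↔
      transgressionCochain N ρ β.1 ∈ coboundaries₂ (Rep.of ρ) :=
    H2π_eq_zero_iff (transgressionCocycle N ρ β)
  rw [h0, mem_coboundaries₂_iff_exists]
  constructor
  · rintro ⟨c, hc⟩
    simp_rw [transgressionCochain_coe β.2] at hc
    have hD : (fun s : F => extendBySection β.1 s - c s) ∈
        cocycles₁ (Rep.of (inflation N ρ)) := by
      refine mem_cocycles_inflation N fun s t => ?_
      rw [map_sub, ← sub_eq_zero]
      have h1 := sub_eq_zero.2 (hc s t)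
      rw [← neg_eq_zero, ← h1]
      abel
    refine ⟨⟨_, hD⟩, Subtype.ext (AddMonoidHom.ext fun n => ?_)⟩
    -- The representative of the class of `1` need not be `1`, so `extendBySection β.1 1` may be
    -- nonzero; it equals `c 1`, since a cocycle vanishes at `1`.
    have h1 := cocycle_map_one N hD
    have h2 := extendBySection_mul β.1 n.toMul 1
    simp only [mul_one] at h2
    change extendBySection β.1 (n.toMul : F) - c (n.toMul : F) = β.1 n
    simp only [QuotientGroup.mk_one] at h1
    rw [h2, quotient_coe_eq_one, add_sub_assoc, h1, add_zero]
    rfl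
  · rintro ⟨D, rfl⟩
    -- The extension and `D` change by the same amount under left multiplication by `n`, so their
    -- difference descends to a cochain `c` on `F ⧸ N`.
    have hg : ∀ (n : N) (s : F), extendBySection (cocycleRestriction N ρ D).1 (n * s)
        - D.1 (n * s) = extendBySection (cocycleRestriction N ρ D).1 s - D.1 s := by
      intro n s
      rw [extendBySection_mul, cocycle_map_mul N D.2, quotient_coe_eq_one, map_one,
        cocycleRestriction_apply, Module.End.one_apply]
      abel
    obtain ⟨c, hc⟩ := exists_descent (N := N)
      (g := fun s => extendBySection (cocycleRestriction N ρ D).1 s - D.1 s) hg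
    refine ⟨c, fun s t => ?_⟩
    rw [transgressionCochain_coe (cocycleRestriction N ρ D).2, hc, hc, hc,
      cocycle_map_mul N D.2, map_sub]
    abel

/-- If every 2-cocycle on `F ⧸ N` becomes a coboundary on `F`, then the transgression is
surjective. -/
theorem transgression_surjective
    (hF : ∀ f ∈ cocycles₂ (Rep.of ρ), ∃ h : F → V, ∀ s t : F,
      f ((s : F ⧸ N), (t : F ⧸ N)) = ρ (s : F ⧸ N) (h t) - h (s * t) + h s) :
    Function.Surjective (transgression N ρ) := by
  intro y
  obtain ⟨f, rfl⟩ := (ModuleCat.epi_iff_surjective (H2π (Rep.of ρ))).1 inferInstance y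
  obtain ⟨h, hh⟩ := hF f.1 f.2
  have h1 (t : F) : f.1 (1, (t : F ⧸ N)) = h 1 := by
    have := hh 1 t
    simpa using this
  have hmul (n : N) (s : F) : h (n * s) = (h n - h 1) + h s := by
    have := hh n s
    rw [quotient_coe_eq_one, h1, map_one, Module.End.one_apply] at this
    rw [this]; abel
  -- Compare the two expressions of `f (s, 1)`, from the pairs `(s, n)` and `(s, 1)`.
  have hmul' (s : F) (n : N) : h (s * n) = ρ (s : F ⧸ N) (h n - h 1) + h s := by
    have e1 := hh s n
    have e2 := hh s 1
    rw [quotient_coe_eq_one] at e1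
    rw [QuotientGroup.mk_one, e1, mul_one] at e2
    rw [map_sub]
    rw [sub_add_cancel, sub_add_eq_add_sub, sub_eq_iff_eq_add] at e2
    rw [← sub_eq_zero] at e2 ⊢
    rw [← neg_eq_zero, ← e2]
    abel
  -- As `f` is not normalized, `h 1` may be nonzero and must be subtracted to obtain a homomorphism.
  let β : Additive N →+ V := AddMonoidHom.mk' (fun n => h (n.toMul : F) - h 1) fun m n => by
    change h ((m.toMul : F) * (n.toMul : F)) - h 1 = _
    rw [hmul]; abel
  have hβ : β ∈ InvariantHom N ρ := mem_invariantHom_iff.2 fun s n => by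
    change h (MulAut.conjNormal s n : N) - h 1 = ρ (s : F ⧸ N) (h n - h 1)
    have e1 := hmul (MulAut.conjNormal s n) s
    have e2 := hmul' s n
    have e3 : ((MulAut.conjNormal s n : N) : F) * s = s * n := by simp
    rw [e3, e2] at e1
    exact (add_right_cancel e1).symm
  refine ⟨⟨β, hβ⟩, (H2π_eq_iff (transgressionCocycle N ρ ⟨β, hβ⟩) f).2 ?_⟩
  change transgressionCochain N ρ β - f.1 ∈ coboundaries₂ (Rep.of ρ)
  rw [mem_coboundaries₂_iff_exists]
  obtain ⟨c, hc⟩ := exists_descent (N := N) (g := fun s => extendBySection β s - h s)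
    fun n s => by
      simp only [extendBySection_mul, hmul]
      change (h n - h 1) + _ - _ = _
      abel
  refine ⟨c, fun s t => ?_⟩
  rw [Pi.sub_apply, transgressionCochain_coe hβ, hc, hc, hc, hh, map_sub]
  abel

end Transgression

/-! ### Cocycles on a free group. -/

section FreeGroupCohomology

open groupCohomology

variable {k : Type u} [CommRing k] {X : Type u} (N : Subgroup (FreeGroup X)) [N.Normal]
  {V : Type u} [AddCommGroup V] [Module k V] (ρ : Representation k (FreeGroup X ⧸ N) V)

/-- A generator acts on `V × (F ⧸ N)` through the extension that is defined by a 2-cocycle. -/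
def twistedAction (f : (FreeGroup X ⧸ N) × (FreeGroup X ⧸ N) → V) (a : FreeGroup X ⧸ N) :
    Equiv.Perm (V × (FreeGroup X ⧸ N)) where
  toFun p := (ρ a p.1 + f (a, p.2), a * p.2)
  invFun p := (ρ a⁻¹ (p.1 - f (a, a⁻¹ * p.2)), a⁻¹ * p.2)
  left_inv p := by simp [← Module.End.mul_apply, ← map_mul]
  right_inv p := by simp [← Module.End.mul_apply, ← map_mul]

/-- By the cocycle identity, permutations of this shape are closed under composition and inversion:
they are the left translations of the extension of `F ⧸ N` by `V` given by `f`. Freeness lifts `F →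
F ⧸ N` to them, and `c` is the `V`-coordinate of the lift. -/
theorem exists_lift_twistedAction_apply {f : (FreeGroup X ⧸ N) × (FreeGroup X ⧸ N) → V}
    (hf : f ∈ cocycles₂ (Rep.of ρ)) (w : FreeGroup X) :
    ∃ c : V, ∀ p, FreeGroup.lift (fun x => twistedAction N ρ f (FreeGroup.of x : FreeGroup X)) w p
      = (ρ (w : FreeGroup X ⧸ N) p.1 + f (w, p.2) + c, (w : FreeGroup X ⧸ N) * p.2) := by
  have hf1 := (mem_cocycles₂_iff (A := Rep.of ρ) f).1 hf
  have hf2 (a) : f (1, a) = f (1, 1) := cocycles₂_map_one_fst (⟨f, hf⟩ : cocycles₂ (Rep.of ρ)) a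
  change ∀ a b c, f (a * b, c) + f (a, b) = ρ a (f (b, c)) + f (a, b * c) at hf1
  induction w using FreeGroup.induction_on with
  | C1 => exact ⟨-f (1, 1), fun p => by simp [hf2 p.2]⟩
  | of x => exact ⟨0, fun p => by rw [FreeGroup.lift_apply_of, add_zero]; rfl⟩
  | inv_of x _ =>
    generalize hT : FreeGroup.lift
      (fun x => twistedAction N ρ f (FreeGroup.of x : FreeGroup X)) = T
    have hx : T (FreeGroup.of x) = twistedAction N ρ f (FreeGroup.of x : FreeGroup X) := by
      rw [← hT, FreeGroup.lift_apply_of]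
    set a : FreeGroup X ⧸ N := QuotientGroup.mk (FreeGroup.of x) with ha
    -- The cocycle identity at `(a, a⁻¹, p.2)` forces this constant and shows that it does not
    -- depend on `p`.
    refine ⟨-ρ a⁻¹ (f (1, 1) + f (a, a⁻¹)), fun p => ?_⟩
    rw [map_inv, hx, Equiv.Perm.inv_eq_iff_eq, QuotientGroup.mk_inv, ← ha]
    have h1 := hf1 a a⁻¹ p.2
    rw [mul_inv_cancel, hf2] at h1
    refine Prod.ext ?_ (by simp [twistedAction])
    change p.1 = ρ a (ρ a⁻¹ p.1 + f (a⁻¹, p.2) + -ρ a⁻¹ (f (1, 1) + f (a, a⁻¹)))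
      + f (a, a⁻¹ * p.2)
    rw [map_add, map_add, map_neg, Representation.self_inv_apply, Representation.self_inv_apply,
      h1]
    abel
  | mul s t hs ht =>
    obtain ⟨c, hc⟩ := hs
    obtain ⟨d, hd⟩ := ht
    refine ⟨f (s, t) + ρ (s : FreeGroup X ⧸ N) d + c, fun p => ?_⟩
    rw [map_mul, Equiv.Perm.mul_apply, hd, hc, QuotientGroup.mk_mul]
    refine Prod.ext ?_ (mul_assoc _ _ _).symm
    have h1 := eq_sub_of_add_eq (hf1 s t p.2)
    change ρ (s : FreeGroup X ⧸ N) (ρ (t : FreeGroup X ⧸ N) p.1 + f (t, p.2) + d)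
      + f (s, t * p.2) + c = _
    simp only [map_add, map_mul, Module.End.mul_apply, h1]
    abel

/-- The second cohomology of a free group vanishes. -/
theorem freeGroup_cocycle₂_splits (f : (FreeGroup X ⧸ N) × (FreeGroup X ⧸ N) → V)
    (hf : f ∈ cocycles₂ (Rep.of ρ)) :
    ∃ h : FreeGroup X → V, ∀ s t : FreeGroup X,
      f ((s : FreeGroup X ⧸ N), (t : FreeGroup X ⧸ N))
        = ρ (s : FreeGroup X ⧸ N) (h t) - h (s * t) + h s := by
  choose c hc using exists_lift_twistedAction_apply N ρ hf
  have hf2 (a) : f (a, 1) = ρ a (f (1, 1)) :=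
    cocycles₂_map_one_snd (⟨f, hf⟩ : cocycles₂ (Rep.of ρ)) a
  -- Evaluating the lift of `s * t` at `(0, 1)` in two ways gives `c (s * t) = f (s, t) + ρ s (c t)
  -- + c s`.
  refine ⟨fun s => -c s, fun s t => ?_⟩
  have h1 := congrArg Prod.fst (hc (s * t) (0, 1))
  rw [map_mul, Equiv.Perm.mul_apply, hc t, hc s] at h1
  simp only [mul_one, map_zero, zero_add] at h1
  rw [hf2 t, hf2 (s * t : FreeGroup X), map_add, QuotientGroup.mk_mul, map_mul,
    Module.End.mul_apply] at h1
  beta_reduce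
  rw [map_neg, ← sub_eq_zero, ← sub_eq_zero.2 h1]
  abel

theorem cocycle_freeGroup_ext {D D' : FreeGroup X → V}
    (hD : D ∈ cocycles₁ (Rep.of (inflation N ρ))) (hD' : D' ∈ cocycles₁ (Rep.of (inflation N ρ)))
    (h : ∀ x, D (FreeGroup.of x) = D' (FreeGroup.of x)) : D = D' := by
  funext w
  induction w using FreeGroup.induction_on with
  | C1 => rw [cocycle_map_one N hD, cocycle_map_one N hD']
  | of x => exact h x
  | inv_of x hx =>
    have e1 := cocycle_map_mul N hD (FreeGroup.of x)⁻¹ (FreeGroup.of x)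
    have e2 := cocycle_map_mul N hD' (FreeGroup.of x)⁻¹ (FreeGroup.of x)
    rw [inv_mul_cancel, cocycle_map_one N hD] at e1
    rw [inv_mul_cancel, cocycle_map_one N hD', ← hx, e1] at e2
    exact add_right_cancel e2
  | mul s t hs ht => rw [cocycle_map_mul N hD, cocycle_map_mul N hD', hs, ht]

end FreeGroupCohomology

/-! ### Kernel and image in terms of the presentation. -/

section PresentedGroup

open groupCohomology

variable {k : Type u} [CommRing k] {X : Type u} {R : Type*} (r : R → FreeGroup X)
  {V : Type u} [AddCommGroup V] [Module k V] (ρ : Representation k (PresGroup r) V)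

/-- Conjugates of the relators generate `N`, and by invariance a zero of `β` at a relator spreads to
its conjugates. -/
theorem evalInvariantHom_injective :
    Function.Injective (evalInvariantHom (relatorSubgroup r) ρ (relator r)) := by
  rw [injective_iff_map_eq_zero]
  intro β hβ
  have hconj (s : FreeGroup X) (n : relatorSubgroup r) (hn : β.1 (Additive.ofMul n) = 0) :
      β.1 (Additive.ofMul (MulAut.conjNormal s n)) = 0 := by
    rw [mem_invariantHom_iff.1 β.2, hn, map_zero]
  have key : ∀ w (hw : w ∈ relatorSubgroup r), β.1 (Additive.ofMul ⟨w, hw⟩) = 0 := by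
    intro w hw
    induction hw using Subgroup.closure_induction with
    | mem w hw =>
      obtain ⟨_, ⟨j, rfl⟩, hj⟩ := Group.mem_conjugatesOfSet_iff.1 hw
      obtain ⟨s, rfl⟩ := isConj_iff.1 hj
      exact hconj s (relator r j) (congrFun hβ j)
    | one => exact map_zero β.1
    | mul s t hs ht h1 h2 =>
      exact (map_add β.1 (Additive.ofMul ⟨s, hs⟩) (Additive.ofMul ⟨t, ht⟩)).trans
        (by rw [h1, h2, add_zero])
    | inv s hs h1 => exact (map_neg β.1 (Additive.ofMul ⟨s, hs⟩)).trans (by rw [h1, neg_zero])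
  exact Subtype.ext (AddMonoidHom.ext fun n => key n.toMul n.toMul.2)

variable {ρ} in
theorem cocycle_presGroup_map_mul {c : PresGroup r → V} (hc : c ∈ cocycles₁ (Rep.of ρ))
    (a b : PresGroup r) : c (a * b) = c a + ρ a (c b) := by
  rw [(mem_cocycles₁_iff (A := Rep.of ρ) c).1 hc a b, add_comm]

variable {ρ} in
theorem cocycle_comp_mk_mem {c : PresGroup r → V} (hc : c ∈ cocycles₁ (Rep.of ρ)) :
    (fun w : FreeGroup X => c w) ∈ cocycles₁ (Rep.of (inflation (relatorSubgroup r) ρ)) :=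
  mem_cocycles_inflation _ fun s t => cocycle_presGroup_map_mul r hc s t

theorem restrict_generators_injOn :
    Set.InjOn (LinearMap.funLeft k V (presGen r))
      (cocycles₁ (Rep.of ρ) : Set (PresGroup r → V)) := by
  intro c hc d hd h
  have := cocycle_freeGroup_ext _ ρ (cocycle_comp_mk_mem r hc) (cocycle_comp_mk_mem r hd)
    fun x => congrFun h x
  funext a
  induction a using QuotientGroup.induction_on with | _ w
  exact congrFun this w

/-- A 1-cocycle on the free group that vanishes at the relators descends to the presented group. -/
theorem exists_cocycle_presGroup {D : FreeGroup X → V}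
    (hD : D ∈ cocycles₁ (Rep.of (inflation (relatorSubgroup r) ρ))) (h : ∀ j, D (r j) = 0) :
    ∃ c ∈ cocycles₁ (Rep.of ρ), ∀ w : FreeGroup X, c (w : PresGroup r) = D w := by
  have h0 : cocycleRestriction (relatorSubgroup r) ρ ⟨D, hD⟩ = 0 :=
    evalInvariantHom_injective r ρ ((funext h).trans (map_zero _).symm)
  have hN (n : relatorSubgroup r) : D n = 0 :=
    DFunLike.congr_fun (congrArg Subtype.val h0) (Additive.ofMul n)
  obtain ⟨c, hc⟩ := exists_descent (N := relatorSubgroup r) (g := D) fun n s => by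
    rw [cocycle_map_mul _ hD, hN, quotient_coe_eq_one, map_one, zero_add, Module.End.one_apply]
  refine ⟨c, (mem_cocycles₁_iff (A := Rep.of ρ) c).2 fun a b => ?_, hc⟩
  induction a using QuotientGroup.induction_on with | _ s
  induction b using QuotientGroup.induction_on with | _ t
  rw [← QuotientGroup.mk_mul, hc, hc, hc, cocycle_map_mul _ hD, add_comm]

variable {r ρ}
  {D : (X → V) →ₗ[k] cocycles₁ (Rep.of (inflation (relatorSubgroup r) ρ))}
  {L : (X → V) →ₗ[k] (R → V)}

/-- Here `D` and `L` stand for `freeCocycle` and `relatorDifferential`; `hD` and `hL` are all that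
the algebra needs of them. -/
theorem freeCocycle_surjective
    (hD : ∀ ξ x, (D ξ).1 (FreeGroup.of x) = ξ x) : Function.Surjective D := fun c =>
  ⟨fun x => c.1 (FreeGroup.of x),
    Subtype.ext (cocycle_freeGroup_ext _ ρ (D _).2 c.2 fun x => hD _ x)⟩

theorem eq_evalInvariantHom_comp
    (hL : ∀ ξ j, L ξ j = (D ξ).1 (r j)) :
    L = (evalInvariantHom (relatorSubgroup r) ρ (relator r)).comp
      ((cocycleRestriction (relatorSubgroup r) ρ).comp D) :=
  LinearMap.ext fun ξ => funext fun j => hL ξ j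

theorem ker_eq_map_cocycles
    (hD : ∀ ξ x, (D ξ).1 (FreeGroup.of x) = ξ x)
    (hL : ∀ ξ j, L ξ j = (D ξ).1 (r j)) :
    LinearMap.ker L = (cocycles₁ (Rep.of ρ)).map (LinearMap.funLeft k V (presGen r)) := by
  ext ξ
  constructor
  · intro hξ
    obtain ⟨c, hc, hcD⟩ := exists_cocycle_presGroup r ρ (D ξ).2
      fun j => (hL ξ j).symm.trans (congrFun hξ j)
    exact ⟨c, hc, funext fun x => (hcD _).trans (hD ξ x)⟩
  · rintro ⟨c, hc, rfl⟩
    have h1 := cocycle_freeGroup_ext _ ρ (D (LinearMap.funLeft k V (presGen r) c)).2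
      (cocycle_comp_mk_mem r hc) fun x => hD _ x
    refine LinearMap.mem_ker.2 (funext fun j => ?_)
    have h2 : ((r j : FreeGroup X) : PresGroup r) = 1 := quotient_coe_eq_one (relator r j)
    rw [hL, h1]
    change c (r j : FreeGroup X) = 0
    rw [h2]
    exact cocycles₁_map_one (⟨c, hc⟩ : cocycles₁ (Rep.of ρ))

variable (ρ) in
theorem transgression_presGroup_surjective :
    Function.Surjective (transgression (relatorSubgroup r) ρ) :=
  transgression_surjective _ ρ (freeGroup_cocycle₂_splits _ ρ)

/-- As `D` is onto, `L` has the image under evaluation of all restricted cocycles, which form the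
kernel of the transgression. -/
theorem range_eq_map_ker_transgression
    (hD : ∀ ξ x, (D ξ).1 (FreeGroup.of x) = ξ x)
    (hL : ∀ ξ j, L ξ j = (D ξ).1 (r j)) :
    LinearMap.range L = (LinearMap.ker (transgression (relatorSubgroup r) ρ)).map
      (evalInvariantHom (relatorSubgroup r) ρ (relator r)) := by
  rw [ker_transgression, eq_evalInvariantHom_comp hL, LinearMap.range_comp,
    LinearMap.range_comp_of_range_eq_top _ (LinearMap.range_eq_top.2 (freeCocycle_surjective hD))]

end PresentedGroup

/-! ### Dimension counts. -/

section Rank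

variable {k : Type u} [Field k] {X : Type u} {R : Type*} [Fintype R] {r : R → FreeGroup X}
  {V : Type u} [AddCommGroup V] [Module k V] [Module.Finite k V]
  (ρ : Representation k (PresGroup r) V)

instance finite_invariantHom : Module.Finite k (InvariantHom (relatorSubgroup r) ρ) :=
  Module.Finite.of_injective _ (evalInvariantHom_injective r ρ)

instance finite_H2_presGroup : Module.Finite k (groupCohomology.H2 (Rep.of ρ)) :=
  Module.Finite.of_surjective _ (transgression_presGroup_surjective ρ)

variable {ρ}
  {D : (X → V) →ₗ[k] groupCohomology.cocycles₁ (Rep.of (inflation (relatorSubgroup r) ρ))}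
  {L : (X → V) →ₗ[k] (R → V)}

theorem finrank_H2_add_finrank_range
    (hD : ∀ ξ x, (D ξ).1 (FreeGroup.of x) = ξ x)
    (hL : ∀ ξ j, L ξ j = (D ξ).1 (r j)) :
    Module.finrank k (groupCohomology.H2 (Rep.of ρ)) + Module.finrank k (LinearMap.range L)
      = Module.finrank k (InvariantHom (relatorSubgroup r) ρ) := by
  rw [range_eq_map_ker_transgression hD hL,
    LinearEquiv.finrank_eq (Submodule.equivMapOfInjective _
      (evalInvariantHom_injective r ρ) _).symm,
    ← LinearMap.finrank_range_add_finrank_ker (transgression (relatorSubgroup r) ρ),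
    LinearMap.range_eq_top.2 (transgression_presGroup_surjective ρ), finrank_top]

/-- Only the equality of dimensions given by `e` enters; the resulting isomorphism is not canonical.
-/
theorem nonempty_coker_equiv_H2
    (hD : ∀ ξ x, (D ξ).1 (FreeGroup.of x) = ξ x)
    (hL : ∀ ξ j, L ξ j = (D ξ).1 (r j))
    (e : InvariantHom (relatorSubgroup r) ρ ≃ₗ[k] (R → V)) :
    Nonempty (((R → V) ⧸ LinearMap.range L) ≃ₗ[k] groupCohomology.H2 (Rep.of ρ)) := by
  refine ⟨LinearEquiv.ofFinrankEq _ _ ?_⟩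
  have h1 := (LinearMap.range L).finrank_quotient_add_finrank
  rw [← e.finrank_eq, ← finrank_H2_add_finrank_range hD hL] at h1
  exact Nat.add_right_cancel h1

end Rank

/-! ### Derivatives on finite powers of a manifold. -/

section PiManifold

variable {𝕜 : Type*} [NontriviallyNormedField 𝕜]
  {E : Type*} [NormedAddCommGroup E] [NormedSpace 𝕜 E]
  {H : Type*} [TopologicalSpace H] {I : ModelWithCorners 𝕜 E H}
  {G : Type*} [TopologicalSpace G] [ChartedSpace H G]
  {E' : Type*} [NormedAddCommGroup E'] [NormedSpace 𝕜 E']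
  {H' : Type*} [TopologicalSpace H'] {J : ModelWithCorners 𝕜 E' H'}
  {M : Type*} [TopologicalSpace M] [ChartedSpace H' M]
  {X : Type*} [Fintype X]

/-- The projections of a finite power of a manifold have the expected derivative. -/
theorem hasMFDerivAt_pi_apply (p : X → G) (x : X) :
    HasMFDerivAt (ModelWithCorners.pi fun _ : X => I) I (fun g : X → G => g x) p
      (ContinuousLinearMap.proj x : (X → E) →L[𝕜] E) := by
  refine ⟨(continuous_apply x).continuousAt, ?_⟩
  refine HasFDerivWithinAt.congr_of_eventuallyEq
    (ContinuousLinearMap.proj x : (X → E) →L[𝕜] E).hasFDerivWithinAt ?_ ?_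
  -- The charts of a power are products of charts, so in them the projection is linear on the chart
  -- target.
  · filter_upwards [extChartAt_target_mem_nhdsWithin
      (I := ModelWithCorners.pi fun _ : X => I) p] with z hz
    have hzx : z x ∈ (extChartAt I (p x)).target := ⟨hz.1 x trivial, hz.2 x trivial⟩
    exact (extChartAt I (p x)).right_inv hzx
  · exact congrArg (extChartAt I (p x)) ((extChartAt I (p x)).left_inv (mem_extChartAt_source _))

/-- A map to a finite power of a manifold is differentiable if its components are. -/
theorem hasMFDerivAt_pi {f : M → X → G} {p : M} {f' : X → E' →L[𝕜] E}
    (h : ∀ x, HasMFDerivAt J I (fun m => f m x) p (f' x)) :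
    HasMFDerivAt J (ModelWithCorners.pi fun _ : X => I) f p
      (ContinuousLinearMap.pi f' : E' →L[𝕜] (X → E)) :=
  ⟨continuousAt_pi.2 fun x => (h x).1, hasFDerivWithinAt_pi.2 fun x => (h x).2⟩

end PiManifold

/-! ### Differentials of word maps. -/

section WordDifferential

variable {𝕜 : Type*} [NontriviallyNormedField 𝕜]
  {E : Type*} [NormedAddCommGroup E] [NormedSpace 𝕜 E]
  {H : Type*} [TopologicalSpace H] (I : ModelWithCorners 𝕜 E H)
  {G : Type*} [TopologicalSpace G] [ChartedSpace H G] [Group G] [LieGroup I ∞ G]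
  {E' : Type*} [NormedAddCommGroup E'] [NormedSpace 𝕜 E']
  {H' : Type*} [TopologicalSpace H'] {J : ModelWithCorners 𝕜 E' H'}
  {M : Type*} [TopologicalSpace M] [ChartedSpace H' M]

theorem mdifferentiableAt_mul (a : G × G) :
    MDifferentiableAt (I.prod I) I (fun a : G × G => a.1 * a.2) a :=
  (contMDiff_mul I ∞).mdifferentiableAt (by simp)

theorem mdifferentiableAt_inv (a : G) : MDifferentiableAt I I (fun a : G => a⁻¹) a :=
  (contMDiff_inv I ∞).mdifferentiableAt (by simp)

variable {I}

theorem hasMFDerivAt_mul_one_one :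
    HasMFDerivAt (I.prod I) I (fun a : G × G => a.1 * a.2) (1, 1)
      (ContinuousLinearMap.fst 𝕜 E E + ContinuousLinearMap.snd 𝕜 E E : E × E →L[𝕜] E) := by
  -- Both partial maps are the identity only up to `mul_one` and `one_mul`; a general `f` and values
  -- in `E` avoid transport between tangent spaces.
  have hid : ∀ f : G → G, f = id →
      (mfderiv I I f 1 : E →L[𝕜] E) = ContinuousLinearMap.id 𝕜 E := by
    rintro _ rfl
    exact mfderiv_id
  have h1 : (mfderiv (I.prod I) I (fun a : G × G => a.1 * a.2) (1, 1) : E × E →L[𝕜] E)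
      = ContinuousLinearMap.fst 𝕜 E E + ContinuousLinearMap.snd 𝕜 E E :=
    (mfderiv_prod_eq_add_comp (mdifferentiableAt_mul I (1, 1))).trans
      (congrArg₂ (fun L L' : E →L[𝕜] E => L.comp (ContinuousLinearMap.fst 𝕜 E E)
        + L'.comp (ContinuousLinearMap.snd 𝕜 E E))
        (hid _ (funext mul_one)) (hid _ (funext one_mul)))
  have h2 := (mdifferentiableAt_mul I ((1, 1) : G × G)).hasMFDerivAt
  exact h1 ▸ h2

/-- The derivative of a product at a point where both factors are the identity. -/
theorem HasMFDerivAt.mul_of_eq_one {u v : M → G} {p : M} {u' v' : E' →L[𝕜] E}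
    (hu : HasMFDerivAt J I u p u') (hv : HasMFDerivAt J I v p v') (hu1 : u p = 1)
    (hv1 : v p = 1) :
    HasMFDerivAt J I (fun m => u m * v m) p (u' + v' : E' →L[𝕜] E) := by
  have h1 : HasMFDerivAt (I.prod I) I (fun a : G × G => a.1 * a.2) (u p, v p)
      (ContinuousLinearMap.fst 𝕜 E E + ContinuousLinearMap.snd 𝕜 E E : E × E →L[𝕜] E) := by
    rw [hu1, hv1]
    exact hasMFDerivAt_mul_one_one
  exact h1.comp p (hu.prodMk hv)

/-- The derivative of a conjugate at a point where its value is the identity. -/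
theorem HasMFDerivAt.conj_of_eq_one {v : M → G} {p : M} {v' : E' →L[𝕜] E} (a : G)
    (hv : HasMFDerivAt J I v p v') (hv1 : v p = 1) :
    HasMFDerivAt J I (fun m => a * v m * a⁻¹) p
      (ContinuousLinearMap.comp (lieAd I a : E →L[𝕜] E) v' : E' →L[𝕜] E) := by
  have h1 : HasMFDerivAt I I (fun h : G => a * h * a⁻¹) (v p) (lieAd I a : E →L[𝕜] E) := by
    rw [hv1]
    exact (mdifferentiableAt_conj I a 1).hasMFDerivAt
  exact h1.comp p hv

variable (I) {X : Type*} [Fintype X]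

theorem mdifferentiableAt_wordMap (w : FreeGroup X) (p : X → G) :
    MDifferentiableAt (ModelWithCorners.pi fun _ : X => I) I (fun g : X → G => wordMap w g) p := by
  induction w using FreeGroup.induction_on with
  | C1 => simpa [wordMap] using mdifferentiableAt_const
  | of x => simpa [wordMap] using (hasMFDerivAt_pi_apply p x).mdifferentiableAt
  | inv_of x h =>
    simpa [wordMap, Function.comp_def] using (mdifferentiableAt_inv I _).comp p h
  | mul s t hs ht =>
    simpa [wordMap, Function.comp_def] using
      (mdifferentiableAt_mul I (wordMap s p, wordMap t p)).comp p (hs.prodMk ht)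

/-- The differential at `p` of the map of a word, translated to the identity. -/
def wordDifferential (p : X → G) (w : FreeGroup X) :
    (X → E) →L[𝕜] GroupLieAlgebra I G :=
  mfderiv (ModelWithCorners.pi fun _ : X => I) I
    (fun g : X → G => wordMap w g * (wordMap w p)⁻¹) p

theorem hasMFDerivAt_wordDifferential (p : X → G) (w : FreeGroup X) :
    HasMFDerivAt (ModelWithCorners.pi fun _ : X => I) I
      (fun g : X → G => wordMap w g * (wordMap w p)⁻¹) p (wordDifferential I p w) := by
  have h1 : ContMDiff I I ∞ fun g : G => g * (wordMap w p)⁻¹ := contMDiff_mul_right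
  exact ((h1.mdifferentiableAt (by simp)).comp p
    (mdifferentiableAt_wordMap I w p)).hasMFDerivAt

/-- With `s(g)` for the value of `s` at `g`, the translated map of `s * t` is `s(g) s(p)⁻¹` times
the conjugate by `s(p)` of `t(g) t(p)⁻¹`. Both factors are `1` at `p`, so their derivatives add, and
conjugation contributes `Ad`. -/
theorem wordDifferential_mul (p : X → G) (s t : FreeGroup X) :
    wordDifferential I p (s * t) = wordDifferential I p s
      + (lieAd I (wordMap s p)).comp (wordDifferential I p t) := by
  have h1 := (hasMFDerivAt_wordDifferential I p s).mul_of_eq_one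
    ((hasMFDerivAt_wordDifferential I p t).conj_of_eq_one (wordMap s p) (mul_inv_cancel _))
    (mul_inv_cancel _) (by simp)
  have h2 : (fun g : X → G => wordMap (s * t) g * (wordMap (s * t) p)⁻¹)
      = fun g => wordMap s g * (wordMap s p)⁻¹
        * (wordMap s p * (wordMap t g * (wordMap t p)⁻¹) * (wordMap s p)⁻¹) := by
    funext g; simp [wordMap, mul_assoc]
  rw [← h2] at h1
  exact h1.mfderiv

theorem mdifferentiableAt_right_translation (a g : G) :
    MDifferentiableAt I I (fun h : G => h * a) g :=
  (contMDiff_mul_right (n := ∞)).mdifferentiableAt (by simp)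

theorem mfderiv_mul_inv_lieTransport (g : G) (v : GroupLieAlgebra I G) :
    (mfderiv I I (fun h : G => h * g⁻¹) g : E →L[𝕜] E) (lieTransport I g v : E) = v := by
  have h1 : HasMFDerivAt I I (fun h : G => h * g) 1 (lieTransport I g : E →L[𝕜] E) :=
    (mdifferentiableAt_right_translation I g 1).hasMFDerivAt
  have h2 : HasMFDerivAt I I (fun h : G => h * g⁻¹) (1 * g)
      (mfderiv I I (fun h : G => h * g⁻¹) g : E →L[𝕜] E) := by
    rw [one_mul]
    exact (mdifferentiableAt_right_translation I g⁻¹ g).hasMFDerivAt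
  have h3 : (fun h : G => h * g⁻¹) ∘ (fun h : G => h * g) = id := by
    funext h; simp
  have h4 := h2.comp 1 h1
  rw [h3] at h4
  exact DFunLike.congr_fun (hasMFDerivAt_unique h4 (hasMFDerivAt_id 1)) v

theorem wordDifferential_of_lieTransportPi (p : X → G) (x : X) (ξ : X → GroupLieAlgebra I G) :
    wordDifferential I p (FreeGroup.of x) (lieTransportPi I p ξ) = ξ x := by
  have h1 := (mdifferentiableAt_right_translation I (p x)⁻¹ (p x)).hasMFDerivAt.comp p
    (hasMFDerivAt_pi_apply (I := I) p x)
  have h2 : ((fun h : G => h * (p x)⁻¹) ∘ fun g : X → G => g x)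
      = fun g => wordMap (FreeGroup.of x) g * (wordMap (FreeGroup.of x) p)⁻¹ := by
    funext g; simp [wordMap]
  rw [h2] at h1
  exact (DFunLike.congr_fun h1.mfderiv (lieTransportPi I p ξ)).trans
    (mfderiv_mul_inv_lieTransport I (p x) (ξ x))

theorem hasMFDerivAt_wordMap_of_eq_one {p : X → G} {w : FreeGroup X} (h : wordMap w p = 1) :
    HasMFDerivAt (ModelWithCorners.pi fun _ : X => I) I (fun g : X → G => wordMap w g) p
      (wordDifferential I p w) := by
  have h1 := hasMFDerivAt_wordDifferential I p w
  have h2 : (fun g : X → G => wordMap w g * (wordMap w p)⁻¹) = fun g => wordMap w g := by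
    funext g; simp [h]
  rwa [h2] at h1

end WordDifferential

theorem wordMap_homPoint {X R : Type*} (r : R → FreeGroup X) {G : Type*} [Group G]
    (φ : PresGroup r →* G) (w : FreeGroup X) :
    wordMap w (homPoint r φ) = φ (w : PresGroup r) := by
  have h1 : FreeGroup.lift (homPoint r φ)
      = φ.comp (QuotientGroup.mk' (relatorSubgroup r)) := by
    ext x; simp [homPoint, presGen]
  rw [wordMap, h1]
  rfl

/-! ### The relator differential and its cocycle. -/

section RelatorDifferential

variable {𝕜 : Type*} [NontriviallyNormedField 𝕜]
  {E : Type*} [NormedAddCommGroup E] [NormedSpace 𝕜 E]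
  {H : Type*} [TopologicalSpace H] (I : ModelWithCorners 𝕜 E H)
  {G : Type*} [TopologicalSpace G] [ChartedSpace H G] [Group G] [LieGroup I ∞ G]
  {X R : Type*} [Fintype X] [Fintype R] (r : R → FreeGroup X) (φ : PresGroup r →* G)

theorem hasMFDerivAt_relatorMap :
    HasMFDerivAt (ModelWithCorners.pi fun _ : X => I) (ModelWithCorners.pi fun _ : R => I)
      (relatorMap r : (X → G) → (R → G)) (homPoint r φ)
      (ContinuousLinearMap.pi fun j => wordDifferential I (homPoint r φ) (r j) :
        (X → E) →L[𝕜] (R → E)) :=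
  hasMFDerivAt_pi fun j =>
    hasMFDerivAt_wordMap_of_eq_one I (congrFun (relatorMap_homPoint r φ) j)

theorem relatorDifferential_apply (ξ : X → GroupLieAlgebra I G) (j : R) :
    relatorDifferential I r φ ξ j
      = wordDifferential I (homPoint r φ) (r j) (lieTransportPi I (homPoint r φ) ξ) :=
  congrFun (DFunLike.congr_fun (hasMFDerivAt_relatorMap I r φ).mfderiv
    (lieTransportPi I (homPoint r φ) ξ)) j

end RelatorDifferential

section FreeCocycle

variable {𝕜 : Type u} [NontriviallyNormedField 𝕜]
  {E : Type u} [NormedAddCommGroup E] [NormedSpace 𝕜 E]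
  {H : Type*} [TopologicalSpace H] (I : ModelWithCorners 𝕜 E H)
  {G : Type*} [TopologicalSpace G] [ChartedSpace H G] [Group G] [LieGroup I ∞ G]
  {X : Type u} [Fintype X] {R : Type*} (r : R → FreeGroup X) (φ : PresGroup r →* G)

/-- The 1-cocycle on the free group with prescribed values at the generators, as the differential
of the word maps. -/
def freeCocycle : (X → GroupLieAlgebra I G) →ₗ[𝕜]
    groupCohomology.cocycles₁ (Rep.of (inflation (relatorSubgroup r) (adRep I φ))) where
  toFun ξ := ⟨fun w => wordDifferential I (homPoint r φ) w (lieTransportPi I (homPoint r φ) ξ),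
    mem_cocycles_inflation _ fun s t => by
      rw [wordDifferential_mul, wordMap_homPoint]
      rfl⟩
  map_add' ξ η := Subtype.ext <| funext fun w =>
    (congrArg (wordDifferential I (homPoint r φ) w)
      (map_add (lieTransportPi I (homPoint r φ)) ξ η)).trans (map_add _ _ _)
  map_smul' c ξ := Subtype.ext <| funext fun w =>
    (congrArg (wordDifferential I (homPoint r φ) w)
      (map_smul (lieTransportPi I (homPoint r φ)) c ξ)).trans (map_smul _ _ _)

theorem freeCocycle_of (ξ : X → GroupLieAlgebra I G) (x : X) :
    (freeCocycle I r φ ξ).1 (FreeGroup.of x) = ξ x :=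
  wordDifferential_of_lieTransportPi I (homPoint r φ) x ξ

end FreeCocycle

end

theorem theorem3p1
    {𝕜 : Type u} [RCLike 𝕜]
    {E : Type u} [NormedAddCommGroup E] [NormedSpace 𝕜 E] [FiniteDimensional 𝕜 E]
    {H : Type*} [TopologicalSpace H] (I : ModelWithCorners 𝕜 E H) [I.Boundaryless]
    {G : Type*} [TopologicalSpace G] [ChartedSpace H G] [Group G] [LieGroup I ∞ G]
    {X : Type u} [Fintype X] {R : Type*} [Fintype R] (r : R → FreeGroup X)
    (φ : PresGroup r →* G) :
    -- the relator map is differentiable at `φ`, so that its differential is meaningful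
    MDifferentiableAt (ModelWithCorners.pi fun _ : X => I) (ModelWithCorners.pi fun _ : R => I)
      (relatorMap r : (X → G) → (R → G)) (homPoint r φ) ∧
    -- the restriction to the generators embeds `Z¹(Π, 𝔤)` in `𝔤^X`, with image the kernel
    Set.InjOn (LinearMap.funLeft 𝕜 (GroupLieAlgebra I G) (presGen r))
      (groupCohomology.cocycles₁ (Rep.of (adRep I φ)) : Set (PresGroup r → GroupLieAlgebra I G)) ∧
    LinearMap.ker (relatorDifferential I r φ) =
      (groupCohomology.cocycles₁ (Rep.of (adRep I φ))).map
        (LinearMap.funLeft 𝕜 (GroupLieAlgebra I G) (presGen r)) ∧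
    -- the evaluation at the relators embeds `Hom(N, 𝔤)^Π` in `𝔤^R`; its image contains the
    -- image of the differential
    Function.Injective (evalInvariantHom (relatorSubgroup r) (adRep I φ) (relator r)) ∧
    LinearMap.range (relatorDifferential I r φ) ≤
      LinearMap.range (evalInvariantHom (relatorSubgroup r) (adRep I φ) (relator r)) ∧
    -- the rank formula
    Module.Finite 𝕜 (InvariantHom (relatorSubgroup r) (adRep I φ)) ∧
    Module.Finite 𝕜 (groupCohomology.H2 (Rep.of (adRep I φ))) ∧
    (Module.finrank 𝕜 (LinearMap.range (relatorDifferential I r φ)) : ℤ) =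
      (Module.finrank 𝕜 (InvariantHom (relatorSubgroup r) (adRep I φ)) : ℤ) -
        (Module.finrank 𝕜 (groupCohomology.H2 (Rep.of (adRep I φ))) : ℤ) ∧
    -- the cokernel
    (Nonempty (InvariantHom (relatorSubgroup r) (adRep I φ) ≃ₗ[𝕜] (R → GroupLieAlgebra I G)) →
      Nonempty (((R → GroupLieAlgebra I G) ⧸ LinearMap.range (relatorDifferential I r φ))
        ≃ₗ[𝕜] groupCohomology.H2 (Rep.of (adRep I φ)))) := by
  have : FiniteDimensional 𝕜 (GroupLieAlgebra I G) := inferInstanceAs (FiniteDimensional 𝕜 E)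
  have hD := freeCocycle_of I r φ
  have hL : ∀ ξ j, relatorDifferential I r φ ξ j = (freeCocycle I r φ ξ).1 (r j) :=
    relatorDifferential_apply I r φ
  refine ⟨(hasMFDerivAt_relatorMap I r φ).mdifferentiableAt,
    restrict_generators_injOn r (adRep I φ), ker_eq_map_cocycles hD hL,
    evalInvariantHom_injective r (adRep I φ), ?_, inferInstance, inferInstance, ?_,
    fun ⟨e⟩ => nonempty_coker_equiv_H2 hD hL e⟩
  · rw [eq_evalInvariantHom_comp hL]
    exact LinearMap.range_comp_le_range _ _
  · rw [← finrank_H2_add_finrank_range hD hL]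
    push_cast
    ring
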